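/- Let $k\ge 0$ and let $q=(q_{ij})$ be a family of complex scalars with $|q_{ij}|=1$ and $q_{ij}=q_{ji}^{-1}$ for $1\le i<j\le k$. Let $T_1,\dots,T_k$ be contractions on the Hilbert space $\mathbb{C}^2$ (that is, $\|T_i\|\le 1$ in the operator norm) such that $T_iT_j=q_{ij}T_jT_i$ for $1\le i<j\le k$. Then either $T_iT_j=T_jT_i$ for all $i,j$, or there exist an invertible operator $P$ on $\mathbb{C}^2$, a complex Hilbert space $\mathcal{K}$, a family $\widetilde q=(\widetilde q_{ij})$ with $|\widetilde q_{ij}|=1$, $\widetilde q_{ij}=\widetilde q_{ji}^{-1}$ and $\widetilde q_{ij}\in\{q_{ij},1\}$ for $1\le i<j\le k$ (so that $\widetilde q\subseteq q\cup\{1\}$), and unitaries $U_1,\dots,U_k$ on $\mathcal{K}$ with $U_iU_j=\widetilde q_{ij}U_jU_i$ for $1\le i<j\le k$, such that, with $\beta=\|P\|\,\|P^{-1}\|$, the tuple $(\beta U_1,\dots,\beta U_k)$ dilates $(P^{-1}T_1P,\dots,P^{-1}T_kP)$; that is, there is a linear isometry $V:\mathbb{C}^2\to\mathcal{K}$ with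 \[ (P^{-1}T_1P)^{m_1}\cdots(P^{-1}T_kP)^{m_k}=V^*(\beta U_1)^{m_1}\cdots(\beta U_k)^{m_k}V \] for all non-negative integers $m_1,\dots,m_k$. -/

import Mathlib

/-- A family `q = (q_ij)` of unimodular scalars with `q_ij = q_ji⁻¹` for `i < j`.
The diagonal entries carry no information and are not constrained. -/
def IsUnimodularFamily {k : ℕ} (q : Fin k → Fin k → ℂ) : Prop :=
  ∀ i j : Fin k, i < j → ‖q i j‖ = 1 ∧ q i j = (q j i)⁻¹

/-- The tuple `T` of bounded operators is `q`-commuting: `q` is a family of unimodular scalars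
and `T_i T_j = q_ij T_j T_i` for `i < j`. -/
def IsQCommuting {k : ℕ} {H : Type*} [NormedAddCommGroup H] [InnerProductSpace ℂ H]
    (q : Fin k → Fin k → ℂ) (T : Fin k → H →L[ℂ] H) : Prop :=
  IsUnimodularFamily q ∧ ∀ i j : Fin k, i < j → T i * T j = q i j • (T j * T i)

/-- The ordered monomial `T_1 ^ m_1 ⋯ T_k ^ m_k`. -/
def tupleMonomial {k : ℕ} {H : Type*} [NormedAddCommGroup H] [InnerProductSpace ℂ H]
    (T : Fin k → H →L[ℂ] H) (m : Fin k → ℕ) : H →L[ℂ] H :=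
  (List.ofFn fun i => T i ^ m i).prod

/-- The tuple `N` on `K` dilates the tuple `T` on `H`: there is an isometry `V : H → K` with
`T_1 ^ m_1 ⋯ T_k ^ m_k = V* N_1 ^ m_1 ⋯ N_k ^ m_k V` for all non-negative integers `m_i`. -/
def Dilates {k : ℕ} {H K : Type*} [NormedAddCommGroup H] [InnerProductSpace ℂ H] [CompleteSpace H]
    [NormedAddCommGroup K] [InnerProductSpace ℂ K] [CompleteSpace K]
    (N : Fin k → K →L[ℂ] K) (T : Fin k → H →L[ℂ] H) : Prop :=
  ∃ V : H →ₗᵢ[ℂ] K, ∀ m : Fin k → ℕ,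
    tupleMonomial T m =
      (ContinuousLinearMap.adjoint V.toContinuousLinearMap).comp
        ((tupleMonomial N m).comp V.toContinuousLinearMap)

open scoped InnerProductSpace ComplexConjugate ENNReal

/-! A noncommuting pair of 2×2 matrices that commutes up to a unimodular scalar is very rigid. If
one member is singular, it is nilpotent, and a basis turns the pair into the Jordan block and a
multiple of `diag(1, ρ)` with `ρ ≠ 1`. If both are invertible, the scalar is `-1` and the pair
becomes multiples of `σ_z` and `σ_x`. Every other `T_i` commutes with both members up to a scalar,
so the same basis `P` puts the whole tuple in the form `c_i w_i`, with `w_i` all from one family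
(`isDiagOrNilpotent_or_isPauliMultiple`).

The `w_i` have unitary dilations: Pauli matrices are already unitary, while `diag(1, ω)` and the
Jordan block are compressions of a diagonal unitary and the backward shift on `ℓ²(ℤ)` to coordinates
`0, 1`. Some entry of `c_i w_i` has modulus `|c_i|`, so `|c_i| ≤ ‖P⁻¹ T_i P‖ ≤ β`. The contractive
scalars `c_i / β` are absorbed one at a time by tensoring with a bilateral shift, which leaves the
commutation relations unchanged (`hasUnitaryDilation_smul`).

The relations of the `w_i` agree with `q` wherever both scalars are nonzero and the `w_i` do not
commute. Where `c_i = 0`, the choice `w_i = 1` gives the relation `1`. -/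

theorem IsUnimodularFamily.of_forall {k : ℕ} {q : Fin k → Fin k → ℂ}
    (h : ∀ i j, ‖q i j‖ = 1) (h' : ∀ i j, q i j = (q j i)⁻¹) : IsUnimodularFamily q :=
  fun i j _ => ⟨h i j, h' i j⟩

/-! ### Dilations: transitivity, scaling and semi-invariant subspaces. -/

section Dilation

variable {k : ℕ} {H K L : Type*}
  [NormedAddCommGroup H] [InnerProductSpace ℂ H]
  [NormedAddCommGroup K] [InnerProductSpace ℂ K]
  [NormedAddCommGroup L] [InnerProductSpace ℂ L]

theorem tupleMonomial_smul (c : Fin k → ℂ) (T : Fin k → H →L[ℂ] H) (m : Fin k → ℕ) :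
    tupleMonomial (fun i => c i • T i) m = (∏ i, c i ^ m i) • tupleMonomial T m := by
  unfold tupleMonomial
  induction k with
  | zero => simp
  | succ k ih =>
    rw [List.ofFn_succ, List.ofFn_succ, List.prod_cons, List.prod_cons,
      ih (fun i => c i.succ) (fun i => T i.succ) (fun i => m i.succ), Fin.prod_univ_succ,
      smul_pow, smul_mul_smul_comm]

variable [CompleteSpace H] [CompleteSpace K] [CompleteSpace L]

theorem Dilates.refl (T : Fin k → H →L[ℂ] H) : Dilates T T :=
  ⟨LinearIsometry.id, fun m => by
    ext x
    refine ext_inner_left ℂ fun y => ?_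
    simp [ContinuousLinearMap.adjoint_inner_right]⟩

theorem Dilates.trans {T : Fin k → H →L[ℂ] H} {N : Fin k → K →L[ℂ] K} {M : Fin k → L →L[ℂ] L}
    (h₁ : Dilates M N) (h₂ : Dilates N T) : Dilates M T := by
  obtain ⟨V, hV⟩ := h₁
  obtain ⟨W, hW⟩ := h₂
  refine ⟨V.comp W, fun m => ?_⟩
  rw [hW, hV]
  ext x
  refine ext_inner_left ℂ fun y => ?_
  simp [ContinuousLinearMap.adjoint_inner_right]

theorem Dilates.smul {T : Fin k → H →L[ℂ] H} {N : Fin k → K →L[ℂ] K} (h : Dilates N T)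
    (c : Fin k → ℂ) : Dilates (fun i => c i • N i) (fun i => c i • T i) := by
  obtain ⟨V, hV⟩ := h
  refine ⟨V, fun m => ?_⟩
  rw [tupleMonomial_smul, tupleMonomial_smul, hV]
  ext x
  simp

/-- A tuple dilates its compressions to a subspace that is co-invariant inside an invariant
subspace. -/
theorem Dilates.of_semiInvariant {T : Fin k → H →L[ℂ] H} {N : Fin k → K →L[ℂ] K} (V : H →ₗᵢ[ℂ] K)
    (M : Set K) (hV : ∀ x, V x ∈ M) (hM : ∀ i, ∀ f ∈ M, N i f ∈ M)
    (hN : ∀ i, ∀ f ∈ M, ContinuousLinearMap.adjoint V.toContinuousLinearMap (N i f) =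
      T i (ContinuousLinearMap.adjoint V.toContinuousLinearMap f)) : Dilates N T := by
  have hadj (x : H) :
      ContinuousLinearMap.adjoint V.toContinuousLinearMap (V x) = x := by
    refine ext_inner_left ℂ fun y => ?_
    simp [ContinuousLinearMap.adjoint_inner_right]
  -- `V*` intertwines `N i` and `T i` only on `M`, so membership in `M` must be carried through each
  -- induction.
  have hpow (i : Fin k) (n : ℕ) (f : K) (hf : f ∈ M) : (N i ^ n) f ∈ M ∧
      ContinuousLinearMap.adjoint V.toContinuousLinearMap ((N i ^ n) f) =
        (T i ^ n) (ContinuousLinearMap.adjoint V.toContinuousLinearMap f) := by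
    induction n with
    | zero => simp [hf]
    | succ n ih =>
      rw [pow_succ', pow_succ', mul_apply_eq_comp, mul_apply_eq_comp]
      exact ⟨hM i _ ih.1, by rw [hN i _ ih.1, ih.2]⟩
  have hlist (m : Fin k → ℕ) (l : List (Fin k)) (f : K) (hf : f ∈ M) :
      (l.map fun i => N i ^ m i).prod f ∈ M ∧
      ContinuousLinearMap.adjoint V.toContinuousLinearMap ((l.map fun i => N i ^ m i).prod f) =
        (l.map fun i => T i ^ m i).prod
          (ContinuousLinearMap.adjoint V.toContinuousLinearMap f) := by
    induction l with
    | nil => simp [hf]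
    | cons i l ih =>
      rw [List.map_cons, List.map_cons, List.prod_cons, List.prod_cons,
        mul_apply_eq_comp, mul_apply_eq_comp, ← ih.2]
      exact hpow i _ _ ih.1
  refine ⟨V, fun m => ?_⟩
  ext x
  have := (hlist m (List.finRange k) (V x) (hV x)).2
  rw [← List.ofFn_eq_map, ← List.ofFn_eq_map, hadj] at this
  exact this.symm

end Dilation

/-! ### Unitary weighted shifts on `ℓ²(ℤ, K)`. -/

section WeightedShift

variable {K : Type*} [NormedAddCommGroup K] [InnerProductSpace ℂ K]

/-- The operator `f ↦ (n ↦ u n (f (n + s)))` on `ℓ²(ℤ, K)`. -/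
noncomputable def weightedShiftIsometry (s : ℤ) (u : ℤ → K ≃ₗᵢ[ℂ] K) :
    lp (fun _ : ℤ => K) 2 →ₗᵢ[ℂ] lp (fun _ : ℤ => K) 2 :=
  LinearMap.isometryOfInner
    { toFun := fun f => ⟨fun n => u n (f (n + s)), by
        refine (memℓp_gen_iff (by simp)).2 ?_
        simp only [LinearIsometryEquiv.norm_map]
        exact ((Equiv.addRight s).summable_iff (f := fun n => ‖f n‖ ^ (2 : ℝ≥0∞).toReal)).2
          ((memℓp_gen_iff (by simp)).1 (lp.memℓp f))⟩
      map_add' := fun f g => by ext n; simp; rfl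
      map_smul' := fun c f => by ext n; simp }
    (fun f g => by
      rw [lp.inner_eq_tsum, lp.inner_eq_tsum,
        ← (Equiv.addRight s).tsum_eq (fun n => ⟪f n, g n⟫_ℂ)]
      simp)

@[simp]
theorem weightedShiftIsometry_apply (s : ℤ) (u : ℤ → K ≃ₗᵢ[ℂ] K) (f : lp (fun _ : ℤ => K) 2)
    (n : ℤ) : weightedShiftIsometry s u f n = u n (f (n + s)) := rfl

/-- `weightedShiftIsometry` as a bounded operator. -/
noncomputable def weightedShift (s : ℤ) (u : ℤ → K ≃ₗᵢ[ℂ] K) :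
    lp (fun _ : ℤ => K) 2 →L[ℂ] lp (fun _ : ℤ => K) 2 :=
  (weightedShiftIsometry s u).toContinuousLinearMap

@[simp]
theorem weightedShift_apply (s : ℤ) (u : ℤ → K ≃ₗᵢ[ℂ] K) (f : lp (fun _ : ℤ => K) 2)
    (n : ℤ) : weightedShift s u f n = u n (f (n + s)) := rfl

theorem weightedShift_mem_unitary [CompleteSpace K] (s : ℤ) (u : ℤ → K ≃ₗᵢ[ℂ] K) :
    weightedShift s u ∈ unitary
      (lp (fun _ : ℤ => K) 2 →L[ℂ] lp (fun _ : ℤ => K) 2) := by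
  have hsurj : Function.Surjective (weightedShiftIsometry s u) := fun g => by
    refine ⟨weightedShiftIsometry (-s) (fun n => (u (n - s)).symm) g, ?_⟩
    ext n
    simp
  let e := LinearIsometryEquiv.ofSurjective (weightedShiftIsometry s u) hsurj
  have h : weightedShift s u = (Unitary.linearIsometryEquiv.symm e : _ →L[ℂ] _) := rfl
  exact h ▸ (Unitary.linearIsometryEquiv.symm e).2

end WeightedShift

/-! ### Unitary dilations and geometric weight vectors. -/

section Scalars

variable {k : ℕ}

/-- The tuple `S` has a unitary dilation that is `q`-commuting. -/
def HasUnitaryDilation {H : Type*} [NormedAddCommGroup H] [InnerProductSpace ℂ H] [CompleteSpace H]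
    (q : Fin k → Fin k → ℂ) (S : Fin k → H →L[ℂ] H) : Prop :=
  ∃ (K : Type) (_ : NormedAddCommGroup K) (_ : InnerProductSpace ℂ K) (_ : CompleteSpace K)
    (U : Fin k → K →L[ℂ] K),
    (∀ i, U i ∈ unitary (K →L[ℂ] K)) ∧ IsQCommuting q U ∧ Dilates U S

theorem HasUnitaryDilation.of_dilates {H K : Type*} [NormedAddCommGroup H] [InnerProductSpace ℂ H]
    [CompleteSpace H] [NormedAddCommGroup K] [InnerProductSpace ℂ K] [CompleteSpace K]
    {q : Fin k → Fin k → ℂ} {S : Fin k → H →L[ℂ] H} {N : Fin k → K →L[ℂ] K}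
    (hN : HasUnitaryDilation q N) (h : Dilates N S) : HasUnitaryDilation q S := by
  obtain ⟨L, i₁, i₂, i₃, U, hU, hq, hd⟩ := hN
  exact ⟨L, i₁, i₂, i₃, U, hU, hq, hd.trans h⟩

/-- Coefficients of the vector of `ℓ²(ℤ)` on which powers of the bilateral shift have the moments
`conj a ^ n`. -/
noncomputable def geometricWeight (a : ℂ) : ℤ → ℂ
  | Int.ofNat n => (Real.sqrt (1 - ‖a‖ ^ 2) : ℂ) * a ^ n
  | Int.negSucc _ => 0

theorem geometricWeight_of_neg (a : ℂ) {n : ℤ} (hn : n < 0) : geometricWeight a n = 0 := by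
  obtain ⟨m, rfl⟩ := Int.eq_negSucc_of_lt_zero hn
  rfl

theorem geometricWeight_add_one (a : ℂ) {n : ℤ} (hn : 0 ≤ n) :
    geometricWeight a (n + 1) = a * geometricWeight a n := by
  lift n to ℕ using hn
  change (Real.sqrt (1 - ‖a‖ ^ 2) : ℂ) * a ^ (n + 1) = a * ((Real.sqrt (1 - ‖a‖ ^ 2) : ℂ) * a ^ n)
  ring

theorem hasSum_geometricWeight {a : ℂ} (ha : ‖a‖ < 1) :
    HasSum (fun n => ‖geometricWeight a n‖ ^ 2) 1 := by
  have h1 : ‖a‖ ^ 2 < 1 := by nlinarith [norm_nonneg a]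
  have h2 : 0 < 1 - ‖a‖ ^ 2 := by linarith
  refine (Function.Injective.hasSum_iff Nat.cast_injective fun n hn => ?_).1 (?_ :
    HasSum ((fun n => ‖geometricWeight a n‖ ^ 2) ∘ ((↑) : ℕ → ℤ)) 1)
  · rw [geometricWeight_of_neg, norm_zero, zero_pow two_ne_zero]
    by_contra! h
    exact hn ⟨n.toNat, Int.toNat_of_nonneg h⟩
  · have := (hasSum_geometric_of_lt_one (sq_nonneg ‖a‖) h1).mul_left (1 - ‖a‖ ^ 2)
    rw [mul_inv_cancel₀ h2.ne'] at this
    refine this.congr_fun fun n => ?_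
    change ‖(Real.sqrt (1 - ‖a‖ ^ 2) : ℂ) * a ^ n‖ ^ 2 = _
    rw [norm_mul, mul_pow, norm_pow, Complex.norm_real, Real.norm_eq_abs, sq_abs,
      Real.sq_sqrt h2.le]
    ring

variable {K : Type*} [NormedAddCommGroup K] [InnerProductSpace ℂ K]

/-- The embedding `x ↦ (n ↦ γ n • x)` of `K` into `ℓ²(ℤ, K)`. -/
noncomputable def weightEmbedding (γ : ℤ → ℂ) (hγ : HasSum (fun n => ‖γ n‖ ^ 2) 1) :
    K →ₗᵢ[ℂ] lp (fun _ : ℤ => K) 2 :=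
  LinearMap.isometryOfInner
    { toFun := fun x => ⟨fun n => γ n • x, by
        refine (memℓp_gen_iff (by simp)).2 ?_
        simpa [norm_smul, mul_pow] using hγ.summable.mul_right (‖x‖ ^ 2)⟩
      map_add' := fun f g => by ext n; simp; rfl
      map_smul' := fun c f => by ext n; simp [smul_comm c] }
    (fun x y => by
      rw [lp.inner_eq_tsum]
      have h : HasSum (fun n => ((‖γ n‖ ^ 2 : ℝ) : ℂ) * ⟪x, y⟫_ℂ) (((1 : ℝ) : ℂ) * ⟪x, y⟫_ℂ) :=
        (Complex.hasSum_ofReal.2 hγ).mul_right _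
      rw [Complex.ofReal_one, one_mul] at h
      rw [← h.tsum_eq]
      refine tsum_congr fun n => ?_
      simp only [LinearMap.coe_mk, AddHom.coe_mk]
      rw [inner_smul_left, inner_smul_right, ← mul_assoc, Complex.conj_mul']
      norm_cast)

@[simp]
theorem weightEmbedding_apply (γ : ℤ → ℂ) (hγ : HasSum (fun n => ‖γ n‖ ^ 2) 1) (x : K) (n : ℤ) :
    weightEmbedding γ hγ x n = γ n • x := rfl

end Scalars

/-! ### Absorbing contractive scalars. -/

section ScalarDilation

variable {k : ℕ} {K : Type} [NormedAddCommGroup K] [InnerProductSpace ℂ K] [CompleteSpace K]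

theorem smul_mem_unitary_of_norm_eq_one {c : ℂ} (hc : ‖c‖ = 1) {W : K →L[ℂ] K}
    (hW : W ∈ unitary (K →L[ℂ] K)) : c • W ∈ unitary (K →L[ℂ] K) := by
  have h : c * conj c = 1 := by rw [Complex.mul_conj']; simp [hc]
  have h' : conj c * c = 1 := by rw [mul_comm, h]
  rw [Unitary.mem_iff] at hW ⊢
  simp [smul_smul, hW.1, hW.2, h, h']

theorem IsQCommuting.smul {H : Type*} [NormedAddCommGroup H] [InnerProductSpace ℂ H]
    {q : Fin k → Fin k → ℂ} {W : Fin k → H →L[ℂ] H} (h : IsQCommuting q W)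
    (c : Fin k → ℂ) : IsQCommuting q (fun i => c i • W i) :=
  ⟨h.1, fun i j hij => by
    dsimp only
    rw [smul_mul_smul_comm, smul_mul_smul_comm, h.2 i j hij, smul_comm (q i j), mul_comm]⟩

/-- Multiplying one member of a `q`-commuting tuple of unitaries by a strict contraction. -/
theorem hasUnitaryDilation_smul_of_lt {q : Fin k → Fin k → ℂ} {W : Fin k → K →L[ℂ] K}
    (hW : ∀ i, W i ∈ unitary (K →L[ℂ] K)) (hq : IsQCommuting q W) (j : Fin k) {c : ℂ}
    (hc : ‖c‖ < 1) :
    HasUnitaryDilation q (fun i => (if i = j then c else 1) • W i) := by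
  have ha : ‖conj c‖ < 1 := by simpa using hc
  let γ := geometricWeight (conj c)
  have hγ : HasSum (fun n => ‖γ n‖ ^ 2) 1 := hasSum_geometricWeight ha
  let u (i : Fin k) : K ≃ₗᵢ[ℂ] K := Unitary.linearIsometryEquiv ⟨W i, hW i⟩
  have hu (i : Fin k) (x : K) : u i x = W i x := rfl
  -- Only the `j`-th unitary is tensored with the forward shift; the others act coordinatewise, so
  -- all commutation relations survive.
  let s (i : Fin k) : ℤ := if i = j then -1 else 0
  refine ⟨lp (fun _ : ℤ => K) 2, inferInstance, inferInstance, inferInstance,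
    fun i => weightedShift (s i) (fun _ => u i), fun i => weightedShift_mem_unitary _ _,
    ⟨hq.1, fun i l hil => ?_⟩, ?_⟩
  · ext f n
    have := congrArg (fun A : K →L[ℂ] K => A (f (n + s i + s l))) (hq.2 i l hil)
    simp only [mul_apply_eq_comp, smul_apply, lp.coeFn_smul, Pi.smul_apply, weightedShift_apply, hu]
      at this ⊢
    rw [this, add_right_comm]
  · refine Dilates.of_semiInvariant (weightEmbedding γ hγ) {f | ∀ n < 0, f n = 0} ?_ ?_ ?_
    · intro x n hn
      simp [γ, geometricWeight_of_neg _ hn]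
    · intro i f hf n hn
      rw [weightedShift_apply, hf, map_zero]
      dsimp only [s]
      split_ifs <;> omega
    · intro i f hf
      refine ext_inner_left ℂ fun x => ?_
      have hWadj : ⟪x, W i (ContinuousLinearMap.adjoint
            (weightEmbedding γ hγ).toContinuousLinearMap f)⟫_ℂ =
          ∑' n, conj (γ n) * ⟪x, W i (f n)⟫_ℂ := by
        rw [← ContinuousLinearMap.adjoint_inner_left, ContinuousLinearMap.adjoint_inner_right,
          lp.inner_eq_tsum]
        refine tsum_congr fun n => ?_
        rw [← ContinuousLinearMap.adjoint_inner_left (W i), ← inner_smul_left]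
        rfl
      rw [ContinuousLinearMap.adjoint_inner_right, smul_apply,
        inner_smul_right, hWadj, lp.inner_eq_tsum, ← tsum_mul_left]
      have hL (n : ℤ) : ⟪(weightEmbedding γ hγ).toContinuousLinearMap x n,
          weightedShift (s i) (fun _ => u i) f n⟫_ℂ =
          conj (γ n) * ⟪x, W i (f (n + s i))⟫_ℂ := by
        rw [← inner_smul_left]
        rfl
      simp only [hL]
      by_cases hij : i = j
      · rw [← (Equiv.addRight (1 : ℤ)).tsum_eq]
        refine tsum_congr fun n => ?_
        simp only [hij, s, if_true, Equiv.coe_addRight, add_neg_cancel_right]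
        -- The recursion `γ (n + 1) = conj c * γ n` can fail at `n = -1`; there the vanishing of `f`
        -- on negative indices takes over.
        rcases lt_or_ge n 0 with hn | hn
        · simp [hf n hn]
        · simp only [γ]
          rw [geometricWeight_add_one _ hn, map_mul, Complex.conj_conj, mul_assoc]
      · simp [s, hij]

theorem hasUnitaryDilation_smul_single {q : Fin k → Fin k → ℂ} {W : Fin k → K →L[ℂ] K}
    (hW : ∀ i, W i ∈ unitary (K →L[ℂ] K)) (hq : IsQCommuting q W) (j : Fin k) {c : ℂ}
    (hc : ‖c‖ ≤ 1) :
    HasUnitaryDilation q (fun i => (if i = j then c else 1) • W i) := by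
  rcases hc.lt_or_eq with h | h
  · exact hasUnitaryDilation_smul_of_lt hW hq j h
  · refine ⟨K, _, _, inferInstance, _, fun i => ?_, hq.smul _, Dilates.refl _⟩
    refine smul_mem_unitary_of_norm_eq_one ?_ (hW i)
    split_ifs <;> simp [h]

/-- A `q`-commuting tuple of contractive multiples of unitaries has a `q`-commuting unitary
dilation. -/
theorem hasUnitaryDilation_smul {q : Fin k → Fin k → ℂ} {W : Fin k → K →L[ℂ] K}
    (hW : ∀ i, W i ∈ unitary (K →L[ℂ] K)) (hq : IsQCommuting q W) {c : Fin k → ℂ}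
    (hc : ∀ i, ‖c i‖ ≤ 1) : HasUnitaryDilation q (fun i => c i • W i) := by
  -- Each dilation is again a `q`-commuting unitary tuple, so the one-scalar case can be iterated.
  suffices h : ∀ s : Finset (Fin k),
      HasUnitaryDilation q (fun i => (if i ∈ s then c i else 1) • W i) by
    simpa using h Finset.univ
  intro s
  induction s using Finset.induction_on with
  | empty => exact ⟨K, _, _, inferInstance, W, hW, hq, by simpa using Dilates.refl W⟩
  | insert j s hj ih =>
    obtain ⟨L, i₁, i₂, i₃, U, hU, hqU, hd⟩ := ih
    refine (hasUnitaryDilation_smul_single hU hqU j (hc j)).of_dilates ?_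
    convert hd.smul (fun i => if i = j then c j else 1) using 2 with i
    by_cases hij : i = j
    · subst hij; simp [hj]
    · simp [hij]

theorem HasUnitaryDilation.smul {H : Type*} [NormedAddCommGroup H] [InnerProductSpace ℂ H]
    [CompleteSpace H] {q : Fin k → Fin k → ℂ} {S : Fin k → H →L[ℂ] H}
    (h : HasUnitaryDilation q S) {c : Fin k → ℂ} (hc : ∀ i, ‖c i‖ ≤ 1) :
    HasUnitaryDilation q (fun i => c i • S i) := by
  obtain ⟨L, i₁, i₂, i₃, U, hU, hqU, hd⟩ := h
  exact (hasUnitaryDilation_smul hU hqU hc).of_dilates (hd.smul c)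

end ScalarDilation

/-! ### Simultaneous normal forms of 2×2 matrices commuting up to scalars. -/

section NormalForms

/-- `diag(1, ω)` for `s = 0`, the nilpotent Jordan block otherwise. -/
def diagOrNilpotent (s : ℤ) (ω : ℂ) : Matrix (Fin 2) (Fin 2) ℂ :=
  if s = 0 then !![1, 0; 0, ω] else !![0, 1; 0, 0]

/-- Scalar multiples of `diag(1, ω)` or of the nilpotent Jordan block. -/
def IsDiagOrNilpotent (X : Matrix (Fin 2) (Fin 2) ℂ) : Prop :=
  ∃ (c : ℂ) (s : ℤ) (ω : ℂ), (s = 0 ∨ s = 1) ∧ ‖ω‖ = 1 ∧ X = c • diagOrNilpotent s ω ∧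
    (c = 0 → s = 0 ∧ ω = 1) ∧ (s = 1 → ω = 1)

/-- The matrices `1`, `σ_z`, `σ_x` and `σ_z σ_x`. -/
def pauliMatrices : Set (Matrix (Fin 2) (Fin 2) ℂ) :=
  {1, !![1, 0; 0, -1], !![0, 1; 1, 0], !![0, 1; -1, 0]}

/-- Scalar multiples of the matrices `1`, `σ_z`, `σ_x` and `σ_z σ_x`. -/
def IsPauliMultiple (X : Matrix (Fin 2) (Fin 2) ℂ) : Prop :=
  ∃ (c : ℂ) (w : Matrix (Fin 2) (Fin 2) ℂ), w ∈ pauliMatrices ∧ X = c • w ∧ (c = 0 → w = 1)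

/-- The relation with the Jordan block makes `C` upper triangular with diagonal `x, r₁⁻¹ x`. If `x ≠
0`, the relation with `diag(1, ρ)` forces `r₂ = 1` and kills the corner. -/
theorem isDiagOrNilpotent_of_qCommute {C : Matrix (Fin 2) (Fin 2) ℂ} {ρ r₁ r₂ : ℂ} (hρ : ρ ≠ 1)
    (hr₁ : ‖r₁‖ = 1)
    (h₁ : C * !![0, 1; 0, 0] = r₁ • (!![0, 1; 0, 0] * C))
    (h₂ : C * !![1, 0; 0, ρ] = r₂ • (!![1, 0; 0, ρ] * C)) : IsDiagOrNilpotent C := by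
  have hr₁0 : r₁ ≠ 0 := by rintro rfl; simp at hr₁
  obtain ⟨x, y, z, w, rfl⟩ : ∃ x y z w, C = !![x, y; z, w] := ⟨_, _, _, _, C.eta_fin_two⟩
  have e₁ := congrFun₂ h₁
  have e₂ := congrFun₂ h₂
  simp [Matrix.mul_apply, Fin.forall_fin_two, Fin.sum_univ_two] at e₁ e₂
  obtain ⟨⟨hz, hx⟩, -⟩ := e₁
  obtain ⟨⟨hx₂, hy₂⟩, -⟩ := e₂
  have hz : z = 0 := by tauto
  subst hz
  by_cases hx0 : x = 0
  · have hw : w = 0 := by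
      rw [hx0] at hx
      exact (mul_eq_zero.1 hx.symm).resolve_left hr₁0
    subst hx0 hw
    by_cases hy : y = 0
    · subst hy
      -- The zero matrix is recorded as `0 • 1`, so that its model commutes with everything.
      refine ⟨0, 0, 1, by simp, by simp, ?_, by simp, by simp⟩
      ext i j; fin_cases i <;> fin_cases j <;> simp
    · refine ⟨y, 1, 1, by simp, by simp, ?_, by simp [hy], by simp⟩
      ext i j; fin_cases i <;> fin_cases j <;> simp [diagOrNilpotent]
  · have hr₂ : r₂ = 1 := by
      rcases hx₂ with h
      grind
    have hy : y = 0 := by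
      subst hr₂
      have : y * (ρ - 1) = 0 := by linear_combination hy₂
      exact (mul_eq_zero.1 this).resolve_right (sub_ne_zero.2 hρ)
    subst hy
    refine ⟨x, 0, r₁⁻¹, by simp, by simp [hr₁], ?_, by simp [hx0], by simp⟩
    have hw : w = x * r₁⁻¹ := by rw [hx]; field_simp
    rw [hw]
    ext i j; fin_cases i <;> fin_cases j <;> simp [diagOrNilpotent]

/-- The relation with `σ_z` makes `C` diagonal or antidiagonal; the one with `σ_x` makes the two
remaining entries equal up to sign. -/
theorem isPauliMultiple_of_qCommute {C : Matrix (Fin 2) (Fin 2) ℂ} {r₁ r₂ : ℂ}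
    (h₁ : C * !![1, 0; 0, -1] = r₁ • (!![1, 0; 0, -1] * C))
    (h₂ : C * !![0, 1; 1, 0] = r₂ • (!![0, 1; 1, 0] * C)) : IsPauliMultiple C := by
  obtain ⟨x, y, z, w, rfl⟩ : ∃ x y z w, C = !![x, y; z, w] := ⟨_, _, _, _, C.eta_fin_two⟩
  have e₁ := congrFun₂ h₁
  have e₂ := congrFun₂ h₂
  simp only [Matrix.mul_apply, Fin.forall_fin_two, Fin.sum_univ_two, Matrix.smul_apply,
    Matrix.of_apply, Matrix.cons_val_zero, Matrix.cons_val_one, smul_eq_mul,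
    Matrix.cons_val', Matrix.cons_val_fin_one] at e₁ e₂
  obtain ⟨⟨a₁, a₂⟩, a₃, a₄⟩ := e₁
  obtain ⟨⟨b₁, b₂⟩, b₃, b₄⟩ := e₂
  by_cases hx : x = 0
  · have hw : w = 0 := by grind
    by_cases hy : y = 0
    · have hz : z = 0 := by grind
      refine ⟨0, 1, by simp [pauliMatrices], ?_, by simp⟩
      ext i j; fin_cases i <;> fin_cases j <;> simp [hx, hy, hz, hw]
    · have hzy : z = y ∨ z = -y := by
        rw [← sq_eq_sq_iff_eq_or_eq_neg]
        grind
      rcases hzy with rfl | rfl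
      · refine ⟨z, !![0, 1; 1, 0], by simp [pauliMatrices], ?_, by simp [hy]⟩
        ext i j; fin_cases i <;> fin_cases j <;> simp [hx, hw]
      · refine ⟨y, !![0, 1; -1, 0], by simp [pauliMatrices], ?_, by simp [hy]⟩
        ext i j; fin_cases i <;> fin_cases j <;> simp [hx, hw]
  · have hr : r₁ = 1 := by grind
    have hy : y = 0 := by grind
    have hz : z = 0 := by grind
    have hwx : w = x ∨ w = -x := by
      rw [← sq_eq_sq_iff_eq_or_eq_neg]
      grind
    rcases hwx with rfl | rfl
    · refine ⟨w, 1, by simp [pauliMatrices], ?_, by simp⟩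
      ext i j; fin_cases i <;> fin_cases j <;> simp [hy, hz]
    · refine ⟨x, !![1, 0; 0, -1], by simp [pauliMatrices], ?_, by simp [hx]⟩
      ext i j; fin_cases i <;> fin_cases j <;> simp [hy, hz]

theorem trace_eq_zero_of_anticommute {n : Type*} [Fintype n] [DecidableEq n] {A B : Matrix n n ℂ}
    (h : A * B = -(B * A)) (hB : B.det ≠ 0) : A.trace = 0 := by
  have h₁ : (A * B * B.adjugate).trace = B.det * A.trace := by
    rw [Matrix.mul_assoc, Matrix.mul_adjugate, Matrix.mul_smul, Matrix.mul_one,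
      Matrix.trace_smul, smul_eq_mul]
  have h₂ : (B * A * B.adjugate).trace = B.det * A.trace := by
    rw [Matrix.trace_mul_comm, ← Matrix.mul_assoc, Matrix.adjugate_mul, Matrix.smul_mul,
      Matrix.one_mul, Matrix.trace_smul, smul_eq_mul]
  rw [h, Matrix.neg_mul, Matrix.trace_neg, h₂] at h₁
  have : B.det * A.trace = 0 := by linear_combination (-1 / 2 : ℂ) * h₁
  exact (mul_eq_zero.1 this).resolve_left hB

theorem sq_smul_one_of_trace_eq_zero {A : Matrix (Fin 2) (Fin 2) ℂ} {a : ℂ} (ht : A.trace = 0)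
    (ha : a ^ 2 = -A.det) : A * A = a ^ 2 • 1 := by
  rw [ha, Matrix.det_fin_two]
  rw [Matrix.trace_fin_two] at ht
  ext i j
  fin_cases i <;> fin_cases j <;>
    simp [Matrix.mul_apply, Fin.sum_univ_two] <;> grind

/-- Determinants give `r ^ 2 = 1`, so `r = -1`; then both traces vanish and both squares are scalar.
If `A v = a v`, then `B v` is an eigenvector for `-a`, and the basis `v, b⁻¹ B v` works. -/
theorem exists_conj_of_det_ne_zero {A B : Matrix (Fin 2) (Fin 2) ℂ} {r : ℂ}
    (h : A * B = r • (B * A)) (hAB : A * B ≠ B * A) (hA : A.det ≠ 0) (hB : B.det ≠ 0) :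
    ∃ (P : Matrix (Fin 2) (Fin 2) ℂ) (a b : ℂ), P.det ≠ 0 ∧ a ≠ 0 ∧ b ≠ 0 ∧
      A * P = P * a • !![1, 0; 0, -1] ∧ B * P = P * b • !![0, 1; 1, 0] := by
  have hr1 : r ≠ 1 := by rintro rfl; simp at h; exact hAB h
  have hdet := congrArg Matrix.det h
  rw [Matrix.det_smul, Matrix.det_mul, Matrix.det_mul, mul_comm B.det, Fintype.card_fin] at hdet
  have hr2 : r ^ 2 = 1 :=
    mul_right_cancel₀ (mul_ne_zero hA hB) (by rw [one_mul]; exact hdet.symm)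
  have hr : r = -1 := ((sq_eq_one_iff.1 hr2).resolve_left hr1)
  subst hr
  rw [neg_one_smul] at h
  have htB : B.trace = 0 := trace_eq_zero_of_anticommute (by rw [h, neg_neg]) hA
  have htA : A.trace = 0 := trace_eq_zero_of_anticommute h hB
  obtain ⟨a, ha⟩ := IsAlgClosed.exists_pow_nat_eq (-A.det) two_pos
  obtain ⟨b, hb⟩ := IsAlgClosed.exists_pow_nat_eq (-B.det) two_pos
  have ha0 : a ≠ 0 := by rintro rfl; apply hA; linear_combination ha
  have hb0 : b ≠ 0 := by rintro rfl; apply hB; linear_combination hb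
  have hB2 := sq_smul_one_of_trace_eq_zero htB hb
  obtain ⟨v, hv0, hv⟩ : ∃ v ≠ 0, (A - a • 1).mulVec v = 0 := by
    rw [Matrix.exists_mulVec_eq_zero_iff]
    rw [Matrix.det_fin_two] at ha ⊢
    rw [Matrix.trace_fin_two] at htA
    simp
    linear_combination ha - a * htA
  rw [Matrix.sub_mulVec, Matrix.smul_mulVec, Matrix.one_mulVec, sub_eq_zero] at hv
  obtain ⟨u, hu⟩ : ∃ u, B.mulVec v = u := ⟨_, rfl⟩
  have hAu : A.mulVec u = -(a • u) := by
    rw [← hu, Matrix.mulVec_mulVec, h, Matrix.neg_mulVec, ← Matrix.mulVec_mulVec, hv,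
      Matrix.mulVec_smul]
  have hBu : B.mulVec u = b ^ 2 • v := by
    rw [← hu, Matrix.mulVec_mulVec, hB2, Matrix.smul_mulVec, Matrix.one_mulVec]
  have e₁ := congrFun hv
  have e₂ := congrFun hu
  have e₃ := congrFun hAu
  have e₄ := congrFun hBu
  simp only [Matrix.mulVec, dotProduct, Fin.sum_univ_two, Fin.forall_fin_two, Pi.smul_apply,
    Pi.neg_apply, smul_eq_mul] at e₁ e₂ e₃ e₄
  -- Eigenvectors for `a` and `-a` are independent; `u ≠ 0` because `B u = b ^ 2 v`.
  have hw : v 0 * u 1 - v 1 * u 0 ≠ 0 := fun hw => by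
    have hcomm (i j : Fin 2) : u i * v j = v i * u j := by
      fin_cases i <;> fin_cases j <;> simp <;> grind
    have hzero (i : Fin 2) : v i • u = 0 := by
      have h₁ : u i • v = v i • u := by
        ext j
        simpa using hcomm i j
      have h₂ := congrArg A.mulVec h₁
      rw [Matrix.mulVec_smul, Matrix.mulVec_smul, hv, hAu, smul_neg, smul_comm _ a,
        smul_comm _ a, h₁, eq_neg_iff_add_eq_zero, ← two_smul ℂ, smul_smul, smul_eq_zero] at h₂
      exact h₂.resolve_left (mul_ne_zero two_ne_zero ha0)
    have hu0 : u = 0 := by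
      obtain ⟨i, hi⟩ := Function.ne_iff.1 hv0
      exact (smul_eq_zero.1 (hzero i)).resolve_left hi
    rw [hu0, Matrix.mulVec_zero] at hBu
    exact (smul_ne_zero (pow_ne_zero 2 hb0) hv0) hBu.symm
  refine ⟨!![v 0, b⁻¹ * u 0; v 1, b⁻¹ * u 1], a, b, ?_, ha0, hb0, ?_, ?_⟩
  · rw [Matrix.det_fin_two_of]
    intro h0
    apply hw
    field_simp at h0
    linear_combination h0
  · ext i j
    fin_cases i <;> fin_cases j <;>
      simp [Matrix.mul_apply, Fin.sum_univ_two] <;> field_simp <;> grind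
  · ext i j
    fin_cases i <;> fin_cases j <;>
      simp [Matrix.mul_apply, Fin.sum_univ_two] <;> field_simp <;> grind

/-- Since `A ^ 2 = tr(A) A`, comparing `A ^ 2 B = r ^ 2 B A ^ 2` with `A B = r B A` gives `tr(A) (1
- r) A B = 0`, hence `A ^ 2 = 0`. In a basis `A v, v` the matrix `B` is upper triangular with
diagonal `x, r x`. -/
theorem exists_conj_of_det_eq_zero {A B : Matrix (Fin 2) (Fin 2) ℂ} {r : ℂ} (hr0 : r ≠ 0)
    (h : A * B = r • (B * A)) (hAB : A * B ≠ B * A) (hA : A.det = 0) :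
    ∃ (P : Matrix (Fin 2) (Fin 2) ℂ) (x : ℂ), P.det ≠ 0 ∧ x ≠ 0 ∧ r ≠ 1 ∧
      A * P = P * !![0, 1; 0, 0] ∧ B * P = P * x • !![1, 0; 0, r] := by
  have hr1 : r ≠ 1 := by rintro rfl; simp at h; exact hAB h
  have hAA : A * A = A.trace • A := by
    rw [Matrix.det_fin_two] at hA
    rw [Matrix.trace_fin_two]
    ext i j
    fin_cases i <;> fin_cases j <;>
      simp [Matrix.mul_apply, Fin.sum_univ_two] <;> grind
  have htA : A.trace = 0 := by
    have h₁ : A * A * B = (r * r) • (B * (A * A)) := by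
      rw [Matrix.mul_assoc, h, Matrix.mul_smul, ← Matrix.mul_assoc, h, Matrix.smul_mul,
        smul_smul, Matrix.mul_assoc]
    rw [hAA, Matrix.smul_mul, Matrix.mul_smul, mul_smul, smul_comm r A.trace, ← h,
      smul_comm r A.trace, ← sub_eq_zero, ← smul_sub, smul_eq_zero] at h₁
    refine h₁.resolve_right fun h₂ => ?_
    have h₃ : (1 - r) • (A * B) = 0 := by rw [sub_smul, one_smul, h₂]
    have h₄ : A * B = 0 := (smul_eq_zero.1 h₃).resolve_left (sub_ne_zero.2 hr1.symm)
    rw [h₄] at h hAB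
    exact hAB ((smul_eq_zero.1 h.symm).resolve_left hr0).symm
  rw [htA, zero_smul] at hAA
  obtain ⟨v, hv⟩ : ∃ v, A.mulVec v ≠ 0 := by
    by_contra! hall
    have : A = 0 := by
      ext i j
      have := congrFun (hall (Pi.single j 1)) i
      simpa using this
    simp [this] at hAB
  obtain ⟨u, hu⟩ : ∃ u, A.mulVec v = u := ⟨_, rfl⟩
  rw [hu] at hv
  have hAu : A.mulVec u = 0 := by rw [← hu, Matrix.mulVec_mulVec, hAA, Matrix.zero_mulVec]
  have e₁ := congrFun hu
  have e₂ := congrFun hAu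
  simp only [Matrix.mulVec, dotProduct, Fin.sum_univ_two, Fin.forall_fin_two,
    Pi.zero_apply] at e₁ e₂
  obtain ⟨P, hP⟩ : ∃ P : Matrix (Fin 2) (Fin 2) ℂ, P = !![u 0, v 0; u 1, v 1] := ⟨_, rfl⟩
  have hPdet : P.det ≠ 0 := fun hdet => by
    rw [hP, Matrix.det_fin_two_of] at hdet
    have hzero (i : Fin 2) : u i • u = 0 := by
      have h₁ : u i • v = v i • u := by
        ext j
        fin_cases i <;> fin_cases j <;> simp <;> grind
      have h₂ := congrArg A.mulVec h₁
      rwa [Matrix.mulVec_smul, Matrix.mulVec_smul, hu, hAu, smul_zero] at h₂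
    obtain ⟨i, hi⟩ := Function.ne_iff.1 hv
    exact hv ((smul_eq_zero.1 (hzero i)).resolve_left hi)
  have hAP : A * P = P * !![0, 1; 0, 0] := by
    rw [hP]
    ext i j
    fin_cases i <;> fin_cases j <;>
      simp [Matrix.mul_apply, Fin.sum_univ_two] <;> grind
  have hPu : IsUnit P.det := isUnit_iff_ne_zero.2 hPdet
  obtain ⟨C, hC⟩ : ∃ C, B * P = P * C :=
    ⟨P⁻¹ * (B * P), by rw [← Matrix.mul_assoc, Matrix.mul_nonsing_inv _ hPu, Matrix.one_mul]⟩
  have hcancel {X Y : Matrix (Fin 2) (Fin 2) ℂ} (hXY : P * X = P * Y) : X = Y := by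
    rw [← Matrix.nonsing_inv_mul_cancel_left P X hPu, hXY,
      Matrix.nonsing_inv_mul_cancel_left P Y hPu]
  have hNC : !![0, 1; 0, 0] * C = r • (C * !![0, 1; 0, 0]) := by
    apply hcancel
    rw [← Matrix.mul_assoc, ← hAP, Matrix.mul_assoc, ← hC, ← Matrix.mul_assoc, h,
      Matrix.smul_mul, Matrix.mul_assoc, hAP, ← Matrix.mul_assoc, hC, Matrix.mul_smul,
      Matrix.mul_assoc]
  have hNC' : !![0, 1; 0, 0] * C ≠ C * !![0, 1; 0, 0] := fun h' => by
    apply hAB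
    have : A * B * P = B * A * P := by
      rw [Matrix.mul_assoc, hC, ← Matrix.mul_assoc, hAP, Matrix.mul_assoc, h',
        ← Matrix.mul_assoc, ← hC, Matrix.mul_assoc, ← hAP, Matrix.mul_assoc]
    rw [← Matrix.mul_nonsing_inv_cancel_right P (A * B) hPu, this,
      Matrix.mul_nonsing_inv_cancel_right P (B * A) hPu]
  obtain ⟨x, y, z, w, rfl⟩ : ∃ x y z w, C = !![x, y; z, w] := ⟨_, _, _, _, C.eta_fin_two⟩
  have e := congrFun₂ hNC
  simp [Matrix.mul_apply, Fin.forall_fin_two, Fin.sum_univ_two] at e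
  obtain ⟨⟨rfl, rfl⟩, -⟩ := e
  have hx : x ≠ 0 := by rintro rfl; simp at hNC'
  have hr1' : r - 1 ≠ 0 := sub_ne_zero.2 hr1
  -- The shear commutes with the Jordan block; its parameter `t` solves `x t + y = r x t`, which
  -- clears the corner of `B`.
  refine ⟨P * !![1, y / (x * (r - 1)); 0, 1], x, ?_, hx, hr1, ?_, ?_⟩
  · rw [Matrix.det_mul, Matrix.det_fin_two_of]
    simpa using hPdet
  · rw [← Matrix.mul_assoc, hAP, Matrix.mul_assoc, Matrix.mul_assoc]
    congr 1
    ext i j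
    fin_cases i <;> fin_cases j <;> simp
  · rw [← Matrix.mul_assoc, hC, Matrix.mul_assoc, Matrix.mul_assoc]
    congr 1
    ext i j
    fin_cases i <;> fin_cases j <;> simp [mul_comm]
    field_simp
    ring

theorem isDiagOrNilpotent_or_isPauliMultiple {ι : Type*} {M : ι → Matrix (Fin 2) (Fin 2) ℂ}
    (hM : ∀ i j, ∃ r : ℂ, ‖r‖ = 1 ∧ M i * M j = r • (M j * M i))
    (hne : ¬ ∀ i j, M i * M j = M j * M i) :
    ∃ P : Matrix (Fin 2) (Fin 2) ℂ, IsUnit P.det ∧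
      ((∀ i, IsDiagOrNilpotent (P⁻¹ * M i * P)) ∨ ∀ i, IsPauliMultiple (P⁻¹ * M i * P)) := by
  have hconj {P : Matrix (Fin 2) (Fin 2) ℂ} (hP : P.det ≠ 0) {X : Matrix (Fin 2) (Fin 2) ℂ}
      {l : ι} {c : ℂ} (hc : c ≠ 0) (hX : M l * P = P * c • X) (i : ι) : ∃ r : ℂ, ‖r‖ = 1 ∧
      P⁻¹ * M i * P * X = r • (X * (P⁻¹ * M i * P)) := by
    have hPu : IsUnit P.det := isUnit_iff_ne_zero.2 hP
    obtain ⟨r, hr, h⟩ := hM i l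
    refine ⟨r, hr, ?_⟩
    have hX' : X = c⁻¹ • (P⁻¹ * M l * P) := by
      rw [Matrix.mul_assoc, hX, Matrix.nonsing_inv_mul_cancel_left _ _ hPu, smul_smul,
        inv_mul_cancel₀ hc, one_smul]
    have hmul (Y Z : Matrix (Fin 2) (Fin 2) ℂ) :
        P⁻¹ * Y * P * (P⁻¹ * Z * P) = P⁻¹ * (Y * Z) * P := by
      simp only [Matrix.mul_assoc, Matrix.mul_nonsing_inv_cancel_left P _ hPu]
    rw [hX', Matrix.mul_smul, Matrix.smul_mul, hmul, hmul, h, Matrix.mul_smul, Matrix.smul_mul,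
      smul_comm]
  have hsing {a b : ι} (hab : M a * M b ≠ M b * M a) (ha : (M a).det = 0) :
      ∃ P : Matrix (Fin 2) (Fin 2) ℂ, IsUnit P.det ∧
        ∀ i, IsDiagOrNilpotent (P⁻¹ * M i * P) := by
    obtain ⟨r, hr, h⟩ := hM a b
    obtain ⟨P, x, hP, hx, hr1, h₁, h₂⟩ :=
      exists_conj_of_det_eq_zero (norm_ne_zero_iff.1 (by simp [hr])) h hab ha
    refine ⟨P, isUnit_iff_ne_zero.2 hP, fun i => ?_⟩
    obtain ⟨r₁, hr₁, e₁⟩ := hconj hP one_ne_zero (by rw [one_smul]; exact h₁) i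
    obtain ⟨r₂, hr₂, e₂⟩ := hconj hP hx h₂ i
    exact isDiagOrNilpotent_of_qCommute hr1 hr₁ e₁ e₂
  push Not at hne
  obtain ⟨a, b, hab⟩ := hne
  by_cases ha : (M a).det = 0
  · obtain ⟨P, hP, h⟩ := hsing hab ha
    exact ⟨P, hP, .inl h⟩
  by_cases hb : (M b).det = 0
  · obtain ⟨P, hP, h⟩ := hsing hab.symm hb
    exact ⟨P, hP, .inl h⟩
  obtain ⟨r, hr, h⟩ := hM a b
  obtain ⟨P, x, y, hP, hx, hy, h₁, h₂⟩ := exists_conj_of_det_ne_zero h hab ha hb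
  refine ⟨P, isUnit_iff_ne_zero.2 hP, .inr fun i => ?_⟩
  obtain ⟨r₁, -, e₁⟩ := hconj hP hx h₁ i
  obtain ⟨r₂, -, e₂⟩ := hconj hP hy h₂ i
  exact isPauliMultiple_of_qCommute e₁ e₂

end NormalForms

/-! ### Unitary dilations of the normal forms. -/

section Models

variable {k : ℕ}

/-- The embedding of `ℂ²` into `ℓ²(ℤ)` as the coordinates `0` and `1`. -/
noncomputable def twoCoordinateEmbedding :
    EuclideanSpace ℂ (Fin 2) →ₗᵢ[ℂ] lp (fun _ : ℤ => ℂ) 2 :=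
  LinearMap.isometryOfInner
    { toFun := fun x => lp.single 2 (0 : ℤ) (x 0) + lp.single 2 (1 : ℤ) (x 1)
      map_add' := fun x y => by simp; abel
      map_smul' := fun c x => by
        simp only [PiLp.smul_apply, lp.single_smul, smul_add, RingHom.id_apply] }
    (fun x y => by
      simp [inner_add_left, lp.inner_single_left, PiLp.inner_apply, Fin.sum_univ_two,
        lp.single_apply])

theorem adjoint_twoCoordinateEmbedding (f : lp (fun _ : ℤ => ℂ) 2) :
    ContinuousLinearMap.adjoint twoCoordinateEmbedding.toContinuousLinearMap f =
      WithLp.toLp 2 ![f 0, f 1] := by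
  refine ext_inner_left ℂ fun x => ?_
  rw [ContinuousLinearMap.adjoint_inner_right]
  change ⟪lp.single 2 (0 : ℤ) (x 0) + lp.single 2 (1 : ℤ) (x 1), f⟫_ℂ = _
  simp [lp.inner_single_left, PiLp.inner_apply, Fin.sum_univ_two]

theorem exists_smul_isometryEquiv {ω : ℂ} (hω : ‖ω‖ = 1) :
    ∃ u : ℤ → ℂ ≃ₗᵢ[ℂ] ℂ, ∀ n z, u n z = ω ^ n * z :=
  ⟨fun n => Unitary.linearIsometryEquiv ⟨(ω ^ n) • (1 : ℂ →L[ℂ] ℂ),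
    smul_mem_unitary_of_norm_eq_one (by simp [hω]) (one_mem _)⟩, fun n z => rfl⟩

theorem hasUnitaryDilation_diagOrNilpotent {s : Fin k → ℤ} {ω : Fin k → ℂ}
    (hs : ∀ i, s i = 0 ∨ s i = 1) (hω : ∀ i, ‖ω i‖ = 1) :
    HasUnitaryDilation (fun i j => ω j ^ s i * (ω i ^ s j)⁻¹)
      (fun i => Matrix.toEuclideanCLM (n := Fin 2) (𝕜 := ℂ) (diagOrNilpotent (s i) (ω i))) := by
  choose u hu using fun i => exists_smul_isometryEquiv (hω i)
  have hω0 (i : Fin k) : ω i ≠ 0 := norm_ne_zero_iff.1 (by simp [hω i])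
  refine ⟨lp (fun _ : ℤ => ℂ) 2, inferInstance, inferInstance, inferInstance,
    fun i => weightedShift (s i) (u i), fun i => weightedShift_mem_unitary _ _,
    ⟨.of_forall (fun i j => by simp [hω]) (fun i j => by simp), fun i j _ => ?_⟩, ?_⟩
  · ext f n
    simp only [mul_apply_eq_comp, smul_apply, lp.coeFn_smul, Pi.smul_apply, smul_eq_mul,
      weightedShift_apply, hu, zpow_add₀ (hω0 _)]
    rw [add_right_comm]
    have := zpow_ne_zero (s j) (hω0 i)
    field_simp
  -- Sequences vanishing from index `2` on are invariant since the shift moves indices down; `f 2 =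
  -- 0` gives the zero second row of the Jordan block.
  · refine Dilates.of_semiInvariant twoCoordinateEmbedding {f | ∀ n, 2 ≤ n → f n = 0} ?_ ?_ ?_
    · intro x n hn
      change (lp.single 2 (0 : ℤ) (x 0) + lp.single 2 (1 : ℤ) (x 1) : lp (fun _ : ℤ => ℂ) 2) n = 0
      have h₀ : n ≠ 0 := by omega
      have h₁ : n ≠ 1 := by omega
      simp [lp.single_apply, h₀, h₁]
    · intro i f hf n hn
      rw [weightedShift_apply, hf, map_zero]
      rcases hs i with h | h <;> omega
    · intro i f hf
      rw [adjoint_twoCoordinateEmbedding, adjoint_twoCoordinateEmbedding,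
        Matrix.toEuclideanCLM_toLp]
      congr 1
      rcases hs i with h | h
      · ext l
        fin_cases l <;>
          simp [h, hu, diagOrNilpotent, Matrix.mulVec, dotProduct, Fin.sum_univ_two]
      · have h2 : f 2 = 0 := hf 2 le_rfl
        ext l
        fin_cases l <;>
          simp [h, hu, diagOrNilpotent, Matrix.mulVec, dotProduct, Fin.sum_univ_two, h2]

theorem toEuclideanCLM_mem_unitary {n : Type*} [Fintype n] [DecidableEq n] {w : Matrix n n ℂ}
    (hw : w ∈ unitary (Matrix n n ℂ)) :
    Matrix.toEuclideanCLM (n := n) (𝕜 := ℂ) w ∈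
      unitary (EuclideanSpace ℂ n →L[ℂ] EuclideanSpace ℂ n) := by
  rw [Unitary.mem_iff] at hw ⊢
  rw [← map_star, ← map_mul, ← map_mul, hw.1, hw.2, map_one]
  simp

theorem mem_unitary_of_mem_pauliMatrices {w : Matrix (Fin 2) (Fin 2) ℂ}
    (hw : w ∈ pauliMatrices) : w ∈ unitary (Matrix (Fin 2) (Fin 2) ℂ) := by
  simp only [pauliMatrices, Set.mem_insert_iff, Set.mem_singleton_iff] at hw
  rw [Unitary.mem_iff, Matrix.star_eq_conjTranspose]
  rcases hw with rfl | rfl | rfl | rfl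
  · simp
  all_goals
    constructor <;> ext i j <;> fin_cases i <;> fin_cases j <;>
      simp [Matrix.mul_apply, Fin.sum_univ_two]

theorem commute_or_anticommute_of_mem_pauliMatrices {v w : Matrix (Fin 2) (Fin 2) ℂ}
    (hv : v ∈ pauliMatrices) (hw : w ∈ pauliMatrices) : v * w = w * v ∨ v * w = -(w * v) := by
  simp only [pauliMatrices, Set.mem_insert_iff, Set.mem_singleton_iff] at hv hw
  rcases hv with rfl | rfl | rfl | rfl <;> rcases hw with rfl | rfl | rfl | rfl <;> simp

open Classical in
theorem hasUnitaryDilation_pauli {w : Fin k → Matrix (Fin 2) (Fin 2) ℂ}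
    (hw : ∀ i, w i ∈ pauliMatrices) :
    HasUnitaryDilation (fun i j => if w i * w j = w j * w i then 1 else -1)
      (fun i => Matrix.toEuclideanCLM (n := Fin 2) (𝕜 := ℂ) (w i)) := by
  refine ⟨EuclideanSpace ℂ (Fin 2), inferInstance, inferInstance, inferInstance, _,
    fun i => toEuclideanCLM_mem_unitary (mem_unitary_of_mem_pauliMatrices (hw i)),
    ⟨.of_forall (fun i j => by split_ifs <;> simp) (fun i j => ?_), fun i j _ => ?_⟩,
    Dilates.refl _⟩
  · simp only [eq_comm (a := w j * w i)]
    split_ifs <;> norm_num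
  · dsimp only
    rw [← map_mul, ← map_mul, ← map_smul]
    congr 1
    split_ifs with h
    · rw [h, one_smul]
    · rw [(commute_or_anticommute_of_mem_pauliMatrices (hw i) (hw j)).resolve_left h,
        neg_one_smul]

end Models

/-! ### Bounding the scalars by `β`. -/

section Bounds

variable {k : ℕ}

theorem norm_entry_le_norm_toEuclideanCLM {n : Type*} [Fintype n] [DecidableEq n]
    (X : Matrix n n ℂ) (a b : n) : ‖X a b‖ ≤ ‖Matrix.toEuclideanCLM (n := n) (𝕜 := ℂ) X‖ := by
  have h₁ : X a b = Matrix.toEuclideanCLM (n := n) (𝕜 := ℂ) X (EuclideanSpace.single b 1) a := by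
    simp [Matrix.ofLp_toEuclideanCLM]
  rw [h₁]
  refine (PiLp.norm_apply_le _ a).trans ((ContinuousLinearMap.le_opNorm _ _).trans ?_)
  simp

theorem norm_le_norm_smul_diagOrNilpotent (c : ℂ) (s : ℤ) (ω : ℂ) :
    ‖c‖ ≤ ‖Matrix.toEuclideanCLM (n := Fin 2) (𝕜 := ℂ) (c • diagOrNilpotent s ω)‖ := by
  by_cases hs : s = 0
  · simpa [diagOrNilpotent, hs] using
      norm_entry_le_norm_toEuclideanCLM (c • diagOrNilpotent s ω) 0 0
  · simpa [diagOrNilpotent, hs] using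
      norm_entry_le_norm_toEuclideanCLM (c • diagOrNilpotent s ω) 0 1

theorem norm_le_norm_smul_pauli (c : ℂ) {w : Matrix (Fin 2) (Fin 2) ℂ} (hw : w ∈ pauliMatrices) :
    ‖c‖ ≤ ‖Matrix.toEuclideanCLM (n := Fin 2) (𝕜 := ℂ) (c • w)‖ := by
  have h₀ := norm_entry_le_norm_toEuclideanCLM (c • w) 0 0
  have h₁ := norm_entry_le_norm_toEuclideanCLM (c • w) 0 1
  simp only [pauliMatrices, Set.mem_insert_iff, Set.mem_singleton_iff] at hw
  rcases hw with rfl | rfl | rfl | rfl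
  · simp
  · simpa using h₀
  · simpa using h₁
  · simpa using h₁

/-- Write `c i = β * (c i / β)`: the contractive factor is absorbed by dilation and the common `β`
is put back afterwards. -/
theorem HasUnitaryDilation.exists_dilates_smul {H : Type*} [NormedAddCommGroup H]
    [InnerProductSpace ℂ H] [CompleteSpace H] {q : Fin k → Fin k → ℂ} {w S : Fin k → H →L[ℂ] H}
    (h : HasUnitaryDilation q w) {c : Fin k → ℂ} (hS : ∀ i, S i = c i • w i) {β : ℝ} (hβ : 0 < β)
    (hc : ∀ i, ‖c i‖ ≤ β) :
    ∃ (K : Type) (_ : NormedAddCommGroup K) (_ : InnerProductSpace ℂ K) (_ : CompleteSpace K)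
      (U : Fin k → K →L[ℂ] K), (∀ i, U i ∈ unitary (K →L[ℂ] K)) ∧ IsQCommuting q U ∧
        Dilates (fun i => (β : ℂ) • U i) S := by
  have hβ0 : (β : ℂ) ≠ 0 := Complex.ofReal_ne_zero.2 hβ.ne'
  obtain ⟨K, i₁, i₂, i₃, U, hU, hqU, hd⟩ := h.smul (c := fun i => c i / β) fun i => by
    rw [norm_div, Complex.norm_real, Real.norm_of_nonneg hβ.le]
    exact (div_le_one hβ).2 (hc i)
  refine ⟨K, i₁, i₂, i₃, U, hU, hqU, ?_⟩
  convert hd.smul (fun _ => (β : ℂ)) using 2 with i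
  rw [hS, smul_smul, mul_div_cancel₀ _ hβ0]

end Bounds

/-! ### The dilation theorem: assembly of the pieces. -/

theorem mainTheorem5 (k : ℕ) (q : Fin k → Fin k → ℂ)
    (T : Fin k → EuclideanSpace ℂ (Fin 2) →L[ℂ] EuclideanSpace ℂ (Fin 2))
    (hT : ∀ i, ‖T i‖ ≤ 1) (hq : IsQCommuting q T) :
    (∀ i j : Fin k, T i * T j = T j * T i) ∨
    ∃ (P : (EuclideanSpace ℂ (Fin 2) →L[ℂ] EuclideanSpace ℂ (Fin 2))ˣ)
      (K : Type) (_ : NormedAddCommGroup K) (_ : InnerProductSpace ℂ K) (_ : CompleteSpace K)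
      (q' : Fin k → Fin k → ℂ) (U : Fin k → K →L[ℂ] K) (β : ℝ),
      β = ‖(P : EuclideanSpace ℂ (Fin 2) →L[ℂ] EuclideanSpace ℂ (Fin 2))‖ *
        ‖((P⁻¹ : (EuclideanSpace ℂ (Fin 2) →L[ℂ] EuclideanSpace ℂ (Fin 2))ˣ) :
          EuclideanSpace ℂ (Fin 2) →L[ℂ] EuclideanSpace ℂ (Fin 2))‖ ∧
      (∀ i, U i ∈ unitary (K →L[ℂ] K)) ∧
      IsQCommuting q' U ∧
      (∀ i j : Fin k, i < j → q' i j = q i j ∨ q' i j = 1) ∧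
      Dilates (fun i => (β : ℂ) • U i)
        (fun i => ((P⁻¹ : (EuclideanSpace ℂ (Fin 2) →L[ℂ] EuclideanSpace ℂ (Fin 2))ˣ) :
          EuclideanSpace ℂ (Fin 2) →L[ℂ] EuclideanSpace ℂ (Fin 2)) * T i *
          (P : EuclideanSpace ℂ (Fin 2) →L[ℂ] EuclideanSpace ℂ (Fin 2))) := by
  refine or_iff_not_imp_left.2 fun hne => ?_
  obtain ⟨Φ, hΦ⟩ : ∃ Φ, Φ = Matrix.toEuclideanCLM (n := Fin 2) (𝕜 := ℂ) := ⟨_, rfl⟩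
  choose M hM using fun i => (⟨Φ.symm (T i), Φ.apply_symm_apply _⟩ : ∃ X, Φ X = T i)
  have hMq (i j : Fin k) (hij : i < j) : M i * M j = q i j • (M j * M i) := by
    refine EquivLike.injective Φ ?_
    rw [map_smul, map_mul, map_mul, hM, hM, hq.2 i j hij]
  have hMM (i j : Fin k) : ∃ r : ℂ, ‖r‖ = 1 ∧ M i * M j = r • (M j * M i) := by
    rcases lt_trichotomy i j with hij | rfl | hij
    · exact ⟨q i j, (hq.1 i j hij).1, hMq i j hij⟩
    · exact ⟨1, by simp, by simp⟩
    · have hn := (hq.1 j i hij).1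
      refine ⟨(q j i)⁻¹, by simp [hn], ?_⟩
      rw [hMq j i hij, smul_smul, inv_mul_cancel₀ (norm_ne_zero_iff.1 (by simp [hn])), one_smul]
  obtain ⟨R, hR, hN⟩ := isDiagOrNilpotent_or_isPauliMultiple hMM fun h => hne fun i j => by
    rw [← hM, ← hM, ← map_mul, h, map_mul]
  obtain ⟨N, hNdef⟩ : ∃ N : Fin k → Matrix (Fin 2) (Fin 2) ℂ, ∀ i, R⁻¹ * M i * R = N i :=
    ⟨_, fun _ => rfl⟩
  simp only [hNdef] at hN
  have hNq (i j : Fin k) (hij : i < j) : N i * N j = q i j • (N j * N i) := by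
    have hmul (Y Z : Matrix (Fin 2) (Fin 2) ℂ) :
        R⁻¹ * Y * R * (R⁻¹ * Z * R) = R⁻¹ * (Y * Z) * R := by
      simp only [Matrix.mul_assoc, Matrix.mul_nonsing_inv_cancel_left R _ hR]
    rw [← hNdef, ← hNdef, hmul, hmul, hMq i j hij, Matrix.mul_smul, Matrix.smul_mul]
  let P : (EuclideanSpace ℂ (Fin 2) →L[ℂ] EuclideanSpace ℂ (Fin 2))ˣ :=
    ⟨Φ R, Φ R⁻¹, by rw [← map_mul, Matrix.mul_nonsing_inv _ hR, map_one],
      by rw [← map_mul, Matrix.nonsing_inv_mul _ hR, map_one]⟩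
  have hS (i : Fin k) : (P⁻¹).1 * T i * P.1 = Φ (N i) := by
    rw [← hNdef, map_mul, map_mul, hM]
    rfl
  obtain ⟨β, hβ⟩ : ∃ β, β = ‖P.1‖ * ‖(P⁻¹).1‖ := ⟨_, rfl⟩
  have hβ0 : 0 < β := by
    rw [hβ]
    exact mul_pos (norm_pos_iff.2 P.ne_zero) (norm_pos_iff.2 (P⁻¹).ne_zero)
  have hSβ (i : Fin k) : ‖Φ (N i)‖ ≤ β := by
    rw [← hS, hβ, mul_comm ‖P.1‖]
    refine (norm_mul_le _ _).trans (mul_le_mul_of_nonneg_right ?_ (norm_nonneg _))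
    exact (norm_mul_le _ _).trans (mul_le_of_le_one_right (norm_nonneg _) (hT i))
  suffices h : ∃ (q' : Fin k → Fin k → ℂ) (c : Fin k → ℂ) (w : Fin k → Matrix (Fin 2) (Fin 2) ℂ),
      HasUnitaryDilation q' (fun i => Φ (w i)) ∧ (∀ i, N i = c i • w i) ∧ (∀ i, ‖c i‖ ≤ β) ∧
        ∀ i j, i < j → q' i j = q i j ∨ q' i j = 1 by
    obtain ⟨q', c, w, hw, hNw, hc, hq'⟩ := h
    obtain ⟨K, i₁, i₂, i₃, U, hU, hqU, hd⟩ := hw.exists_dilates_smul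
      (S := fun i => (P⁻¹).1 * T i * P.1) (c := c)
      (fun i => by rw [hS, hNw, map_smul]) hβ0 hc
    exact ⟨P, K, i₁, i₂, i₃, q', U, β, hβ, hU, hqU, hq', hd⟩
  subst hΦ
  rcases hN with hN | hN
  · choose c s ω hs hω hNc hc0 hs1 using hN
    refine ⟨_, c, _, hasUnitaryDilation_diagOrNilpotent hs hω, hNc, fun i =>
      (norm_le_norm_smul_diagOrNilpotent (c i) (s i) (ω i)).trans (hNc i ▸ hSβ i),
      fun i j hij => ?_⟩
    -- A model different from the identity carries a nonzero scalar, which can be cancelled from the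
    -- relation to read off `q i j`.
    have hc (l : Fin k) (hl : s l = 1 ∨ ω l ≠ 1) : c l ≠ 0 := fun h => by
      have := hc0 l h
      rcases hl with hl | hl
      · omega
      · exact hl this.2
    have e := hNq i j hij
    rw [hNc i, hNc j] at e
    rcases hs i with hi | hi <;> rcases hs j with hj | hj
    · right; simp [hi, hj]
    · by_cases h1 : ω i = 1
      · right; simp [hi, h1]
      left
      have h01 := congrFun₂ e 0 1
      have hci := hc i (.inr h1)
      have hcj := hc j (.inl hj)
      have hω0 : ω i ≠ 0 := norm_ne_zero_iff.1 (by simp [hω i])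
      simp [diagOrNilpotent, hi, hj, Matrix.mul_apply, Fin.sum_univ_two] at h01 ⊢
      field_simp at h01
      exact (eq_inv_of_mul_eq_one_left h01.symm).symm
    · by_cases h1 : ω j = 1
      · right; simp [hj, h1]
      left
      have h01 := congrFun₂ e 0 1
      have hci := hc i (.inl hi)
      have hcj := hc j (.inr h1)
      simp [diagOrNilpotent, hi, hj, Matrix.mul_apply, Fin.sum_univ_two] at h01 ⊢
      field_simp at h01
      exact h01
    -- Two Jordan blocks have product zero, so `q i j` is undetermined; normalising `ω = 1` makes
    -- the model relation `1`.
    · right; simp [hs1 i hi, hs1 j hj]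
  · choose c w hw hNc hc0 using hN
    refine ⟨_, c, w, hasUnitaryDilation_pauli hw, hNc, fun i =>
      (norm_le_norm_smul_pauli (c i) (hw i)).trans (hNc i ▸ hSβ i), fun i j hij => ?_⟩
    split_ifs with hcomm
    · exact .inr rfl
    left
    have hci : c i ≠ 0 := fun h => hcomm (by simp [hc0 i h])
    have hcj : c j ≠ 0 := fun h => hcomm (by simp [hc0 j h])
    have e := hNq i j hij
    have ha := (commute_or_anticommute_of_mem_pauliMatrices (hw i) (hw j)).resolve_left hcomm
    rw [hNc i, hNc j, smul_mul_smul_comm, smul_mul_smul_comm, smul_comm (q i j),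
      mul_comm (c j)] at e
    have e' := smul_right_injective _ (mul_ne_zero hci hcj) e
    -- Anticommutation and the `q`-relation give `q i j = -1`, unless `w j * w i = 0`, which would
    -- make the pair commute.
    rw [ha, ← neg_one_smul ℂ, ← sub_eq_zero, ← sub_smul, smul_eq_zero] at e'
    refine sub_eq_zero.1 (e'.resolve_right fun h0 => hcomm ?_)
    rw [ha, h0, neg_zero]
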